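/- Let $\Phi=\{\Phi_t\colon \mathbb M_n(\mathbb C)\to\mathbb M_n(\mathbb C)\}_{t\in\mathbb R}$ be a one-parameter family of hermiticity-preserving superoperators, i.e. a family of linear maps for which there are $s\ge 1$, polynomials $\alpha_1,\dots,\alpha_s\in\mathbb R[t]$ without real roots and $n\times n$ matrices $A_1,\dots,A_s$ with entries in $\mathbb C[t]$ such that $$\Phi_t(X)=\sum_{r=1}^{s}\alpha_r(t)\,A_r(t)\,X\,A_r(t)^*\qquad(t\in\mathbb R,\ X\in\mathbb M_n(\mathbb C)).$$ Let $\chi_\Phi\in\mathbb R[t][x]$ be the characteristic polynomial of the family, i.e. the unique polynomial such that, for every $t\in\mathbb R$, $\chi_\Phi(t,x)=\det\bigl(M_t-xI\bigr)$, where $M_t=\sum_{i,j=1}^n E_{ij}\otimes\Phi_t(E_{ij})$ is the $n^2\times n^2$ Choi–Jamiołkowski matrix of $\Phi_t$ and the $E_{ij}$ are the matrix units. Let $f=\chi_\Phi^-\in\mathbb R[t][x]$ be given by $f(t,x)=\chi_\Phi(t,-x)$, and write $$f(t,x)=a_{n_k}(t)x^{n_k}+\dots+a_{n_1}(t)x^{n_1}+a_{n_0}(t)x^{n_0},\qquad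 n_k>\dots>n_1>n_0\ge 0,$$ with nonzero polynomials $a_{n_i}\in\mathbb R[t]$. For a word $\sigma=\sigma_k\sigma_{k-1}\cdots\sigma_0$ of length $k+1$ over the alphabet $\{+,-\}$, the sign variation formula $\varphi_\sigma^f(t)$ of type $\sigma$ for $f$ is the conjunction, over $i=k,\dots,0$, of the conditions $a_{n_i}(t)>0$ if $\sigma_i=+$ and $a_{n_i}(t)<0$ if $\sigma_i=-$. Let $\lambda(\sigma)$ be the number of sign variations in $\sigma$, i.e. of pairs of consecutive letters $+-$ or $-+$, and assume that $\lambda(\sigma)\ge n^2-2n+2$. A superoperator is called positive if it maps positive semidefinite matrices to positive semidefinite matrices. Then the following hold. 1. If $\varphi_\sigma^f(t)$ holds for all $t\in\mathbb R$, then $\Phi$ is globally nonpositive: $\Phi_t$ is not positive for every $t\in\mathbb R$. 2. If there is an open interval $(u,v)\subseteq\mathbb R$, $u<v$, such that $\varphi_\sigma^f(t)$ holds for all $t\in(u,v)$, then $\Phi$ is locally nonpositive: there is an open interval $(u',v')\subseteq\mathbb R$, $u'<v'$, such that $\Phi_t$ is not positive for every $t\in(u',v')$. 3. If $\varphi_\sigma^f(t)$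 holds for some $t\in\mathbb R$, then $\Phi$ is pointwise nonpositive: there is $t\in\mathbb R$ such that $\Phi_t$ is not positive. -/

import Mathlib

open Polynomial
open scoped Kronecker ComplexOrder

namespace Superop

/-- A superoperator: an element of `L(M_n(ℂ))`. -/
abbrev Superoperator (n : ℕ) : Type :=
  Matrix (Fin n) (Fin n) ℂ →ₗ[ℂ] Matrix (Fin n) (Fin n) ℂ

/-- `Φ` is positive if it maps semipositive matrices to semipositive matrices. -/
def IsPositive {n : ℕ} (Φ : Superoperator n) : Prop :=
  ∀ X : Matrix (Fin n) (Fin n) ℂ, X.PosSemidef → (Φ X).PosSemidef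

/-- The Choi-Jamiolkowski matrix `∑ i j, E_ij ⊗ Φ(E_ij)`. -/
noncomputable def cjMatrix {n : ℕ} (Φ : Superoperator n) :
    Matrix (Fin n × Fin n) (Fin n × Fin n) ℂ :=
  ∑ i : Fin n, ∑ j : Fin n,
    (Matrix.single i j (1 : ℂ)) ⊗ₖ Φ (Matrix.single i j (1 : ℂ))

/-- The polynomial `det (M - x I)`, with coefficients in a commutative ring. -/
noncomputable def detSub {R ι : Type*} [CommRing R] [Fintype ι] [DecidableEq ι]
    (M : Matrix ι ι R) : R[X] :=
  (M.map (C : R → R[X]) - (X : R[X]) • (1 : Matrix ι ι R[X])).det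

/-- The characteristic polynomial `det (M - x I)` of the Choi-Jamiolkowski matrix `M` of `Φ`. -/
noncomputable def charPoly {n : ℕ} (Φ : Superoperator n) : ℂ[X] :=
  detSub (cjMatrix Φ)

/-- The value at the real number `t` of a matrix of complex polynomials in one real variable. -/
noncomputable def evalMatrix {n : ℕ} (A : Matrix (Fin n) (Fin n) ℂ[X]) (t : ℝ) :
    Matrix (Fin n) (Fin n) ℂ :=
  A.map (fun p => p.eval (t : ℂ))

/-- One-parameter families of hermiticity-preserving superoperators: for some `s ≥ 1`,
`Φ_t(X) = ∑ r, α_r(t) A_r(t) X A_r(t)*` for all real `t`, where the `α_r` are real polynomials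
without real roots and the `A_r` are matrices of complex polynomials. -/
def IsOneParameterFamily {n : ℕ} (Φ : ℝ → Superoperator n) : Prop :=
  ∃ s : ℕ, 1 ≤ s ∧ ∃ (α : Fin s → ℝ[X]) (A : Fin s → Matrix (Fin n) (Fin n) ℂ[X]),
    (∀ (r : Fin s) (t : ℝ), (α r).eval t ≠ 0) ∧
    ∀ (t : ℝ) (Y : Matrix (Fin n) (Fin n) ℂ),
      Φ t Y = ∑ r : Fin s, (((α r).eval t : ℝ) : ℂ) •
        (evalMatrix (A r) t * Y * (evalMatrix (A r) t).conjTranspose)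

def GloballyNonpositive {n : ℕ} (Φ : ℝ → Superoperator n) : Prop :=
  ∀ t : ℝ, ¬ IsPositive (Φ t)

def LocallyNonpositive {n : ℕ} (Φ : ℝ → Superoperator n) : Prop :=
  ∃ u v : ℝ, u < v ∧ ∀ t ∈ Set.Ioo u v, ¬ IsPositive (Φ t)

def PointwiseNonpositive {n : ℕ} (Φ : ℝ → Superoperator n) : Prop :=
  ∃ t : ℝ, ¬ IsPositive (Φ t)

/-- For `f ∈ ℝ[t][x]` and a real number `t`, the polynomial `f(t) ∈ ℝ[x]`. -/
noncomputable def specialize (f : ℝ[X][X]) (t : ℝ) : ℝ[X] :=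
  f.map (evalRingHom t)

theorem detSub_map {R S ι : Type*} [CommRing R] [CommRing S] [Fintype ι] [DecidableEq ι]
    (g : R →+* S) (M : Matrix ι ι R) :
    (detSub M).map g = detSub (M.map g) := by
  unfold detSub
  rw [← coe_mapRingHom, RingHom.map_det]
  congr 1
  ext i j : 2
  by_cases h : i = j <;> simp [h]

theorem detSub_transpose {R ι : Type*} [CommRing R] [Fintype ι] [DecidableEq ι]
    (M : Matrix ι ι R) : detSub M.transpose = detSub M := by
  unfold detSub
  rw [← Matrix.det_transpose]
  congr 1
  ext i j : 2
  by_cases h : i = j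
  · simp [h]
  · simp [h, Ne.symm h]

theorem cjMatrix_apply {n : ℕ} (Φ : Superoperator n) (i j k l : Fin n) :
    cjMatrix Φ (i, j) (k, l) = Φ (Matrix.single i k 1) j l := by
  unfold cjMatrix
  simp only [Matrix.sum_apply, Matrix.kroneckerMap_apply, Matrix.single_apply]
  rw [Finset.sum_eq_single i, Finset.sum_eq_single k] <;> simp +contextual

/-- The characteristic polynomials of the members of a one-parameter family are the
specializations of one and only one polynomial in `ℝ[t][x]`. -/
theorem existsUnique_familyCharPoly {n : ℕ} (Φ : ℝ → Superoperator n)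
    (hΦ : IsOneParameterFamily Φ) :
    ∃! f : ℝ[X][X], ∀ t : ℝ, (specialize f t).map Complex.ofRealHom = charPoly (Φ t) := by
  obtain ⟨s, -, α, A, -, hA⟩ := hΦ
  refine existsUnique_of_exists_of_unique ?_ ?_
  · let N : Matrix (Fin n × Fin n) (Fin n × Fin n) ℂ[X] := Matrix.of fun p q =>
      ∑ r, (α r).map Complex.ofRealHom * A r p.2 p.1 * (A r q.2 q.1).map (starRingEnd ℂ)
    have hN : ∀ t : ℝ, N.map (evalRingHom (t : ℂ)) = cjMatrix (Φ t) := by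
      intro t
      ext ⟨i, j⟩ ⟨k, l⟩
      rw [cjMatrix_apply, hA]
      simp only [N, Matrix.map_apply, Matrix.of_apply, Matrix.sum_apply, coe_evalRingHom,
        eval_finsetSum, eval_mul]
      refine Finset.sum_congr rfl fun r _ => ?_
      have h1 : eval (t : ℂ) ((α r).map Complex.ofRealHom) = (((α r).eval t : ℝ) : ℂ) := by
        have := Polynomial.eval_map_apply (f := Complex.ofRealHom) (p := α r) (x := t)
        simpa using this
      have h2 : eval (t : ℂ) ((A r l k).map (starRingEnd ℂ)) =
          starRingEnd ℂ ((A r l k).eval (t : ℂ)) := by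
        have := Polynomial.eval_map_apply (f := starRingEnd ℂ) (p := A r l k) (x := (t : ℂ))
        simpa using this
      rw [h1, h2]
      simp [evalMatrix, Matrix.mul_apply, Matrix.single_apply, mul_assoc, ite_and]
    have hconj : N.map (mapRingHom (starRingEnd ℂ)) = N.transpose := by
      ext1 ⟨i, j⟩ ⟨k, l⟩
      simp only [N, Matrix.map_apply, Matrix.of_apply, Matrix.transpose_apply, coe_mapRingHom,
        Polynomial.map_sum, Polynomial.map_mul, Polynomial.map_map]
      refine Finset.sum_congr rfl fun r _ => ?_
      have e1 : (starRingEnd ℂ).comp Complex.ofRealHom = Complex.ofRealHom := by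
        ext; simp
      have e2 : (starRingEnd ℂ).comp (starRingEnd ℂ) = RingHom.id ℂ := by
        ext; simp
      rw [e1, e2, Polynomial.map_id]
      ring
    have hreal : (detSub N).map (mapRingHom (starRingEnd ℂ)) = detSub N := by
      rw [detSub_map, hconj, detSub_transpose]
    have hlift : detSub N ∈ Polynomial.lifts (mapRingHom Complex.ofRealHom) := by
      rw [Polynomial.lifts_iff_coeff_lifts]
      intro m
      have : (detSub N).coeff m ∈ Polynomial.lifts Complex.ofRealHom := by
        rw [Polynomial.lifts_iff_coeff_lifts]
        intro k
        have h := congrArg (fun p => (p.coeff m).coeff k) hreal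
        simp only [coeff_map, coe_mapRingHom] at h
        exact ⟨(((detSub N).coeff m).coeff k).re, Complex.conj_eq_iff_re.mp h⟩
      obtain ⟨q, hq⟩ := (Polynomial.mem_lifts _).mp this
      exact ⟨q, hq⟩
    obtain ⟨f, hf⟩ := (Polynomial.mem_lifts _).mp hlift
    refine ⟨f, fun t => ?_⟩
    rw [charPoly, ← hN, ← detSub_map, ← hf, specialize, Polynomial.map_map, Polynomial.map_map]
    congr 1
    ext <;> simp
  · intro f g hf hg
    ext1 m
    refine Polynomial.funext fun t => ?_
    have h := Polynomial.map_injective _ Complex.ofRealHom.injective ((hf t).trans (hg t).symm)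
    simpa [specialize] using congrArg (fun p => p.coeff m) h

/-- The characteristic polynomial of a one-parameter family `Φ`: the polynomial in `ℝ[t][x]` whose
specialization at every real `t` is the characteristic polynomial of `Φ_t`. -/
noncomputable def familyCharPoly {n : ℕ} (Φ : ℝ → Superoperator n)
    (hΦ : IsOneParameterFamily Φ) : ℝ[X][X] :=
  (existsUnique_familyCharPoly Φ hΦ).choose

theorem familyCharPoly_spec {n : ℕ} (Φ : ℝ → Superoperator n)
    (hΦ : IsOneParameterFamily Φ) (t : ℝ) :
    (specialize (familyCharPoly Φ hΦ) t).map Complex.ofRealHom = charPoly (Φ t) :=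
  (existsUnique_familyCharPoly Φ hΦ).choose_spec.1 t

/-- The polynomial `f⁻(t, x) = f(t, -x)`. -/
noncomputable def negVar (f : ℝ[X][X]) : ℝ[X][X] :=
  f.comp (-X)

/-- The coefficient sequence of `f ∈ ℝ[t][x]`: the nonzero coefficients, which are elements of
`ℝ[t]`, listed by strictly decreasing degree in `x`. -/
noncomputable def coeffSeq (f : ℝ[X][X]) : List ℝ[X] :=
  (f.support.sort (fun a b => b ≤ a)).map f.coeff

/-- The two letters `+` and `-`. -/
inductive Sgn : Type
  | plus : Sgn
  | minus : Sgn
  deriving DecidableEq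

/-- The number of subwords `+-` and `-+` of a word. -/
def signVariations : List Sgn → ℕ
  | a :: b :: w => (if a = b then 0 else 1) + signVariations (b :: w)
  | _ => 0

/-- Sign variation formulas. `atom s a` is the formula `a(t) > 0` or `a(t) < 0`, according to the
letter `s`; `conj φ s a` is the conjunction of `φ` with this formula, written on the right. -/
inductive SignVariationFormula : Type
  | atom (s : Sgn) (a : ℝ[X]) : SignVariationFormula
  | conj (φ : SignVariationFormula) (s : Sgn) (a : ℝ[X]) : SignVariationFormula

/-- The truth of `a(t) > 0` (letter `+`) or `a(t) < 0` (letter `-`) at a real number `t`. -/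
def componentHolds (a : ℝ[X]) (t : ℝ) : Sgn → Prop
  | Sgn.plus => 0 < a.eval t
  | Sgn.minus => a.eval t < 0

namespace SignVariationFormula

/-- The type of a sign variation formula, a word over the letters `+` and `-`. -/
def type : SignVariationFormula → List Sgn
  | atom s _ => [s]
  | conj φ s _ => φ.type ++ [s]

/-- The domain of a sign variation formula: the sequence of its polynomials. -/
noncomputable def domain : SignVariationFormula → List ℝ[X]
  | atom _ a => [a]
  | conj φ _ a => φ.domain ++ [a]

/-- The formula holds at the real number `t`. -/
def Holds : SignVariationFormula → ℝ → Prop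
  | atom s a, t => componentHolds a t s
  | conj φ s a, t => φ.Holds t ∧ componentHolds a t s

/-- `φ` is a sign variation formula of type `σ` for the polynomial `f ∈ ℝ[t][x]`. -/
def IsOfTypeFor (φ : SignVariationFormula) (σ : List Sgn) (f : ℝ[X][X]) : Prop :=
  φ.type = σ ∧ φ.domain = coeffSeq f

end SignVariationFormula

end Superop

/-!
The Choi–Jamiołkowski matrix `M` of `Φ_t` is hermitian, so `f(t, x) = det (M + x I)` is the product
of the factors `x + λ` over the eigenvalues `λ` of `M`. For a polynomial all of whose roots are real,
Descartes' rule is sharp in the direction that matters here: the sign variations of `P(x)` and of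
`P(-x)` together with the order of vanishing at `0` add up to at most the degree
(`Polynomial.signVariations_add_signVariations_comp_neg_X_le`), and Descartes' rule bounds the
number of negative roots by the sign variations of `P(-x)`. Hence
`Polynomial.signVariations_prod_add_card_le`: the number of sign variations of `f(t, ·)` is at most
the number of negative eigenvalues of `M`. If a sign variation formula of type `σ` holds at `t`, this
number of sign variations is `λ(σ)` (`Superop.signVariations_specialize`), so at most `2n - 2`
eigenvalues are nonnegative.

On the other hand, if `Φ_t` is positive, the hermitian form of `M` is nonnegative at all product
vectors `x ⊗ y` (`Superop.IsPositive.cjMatrix_product_nonneg`). Orthogonality of `x ⊗ y` to the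
eigenvectors with nonnegative eigenvalues amounts to at most `2n - 2` bilinear equations, and these
always have a solution with `x` and `y` nonzero (`MvPolynomial.exists_common_zero_of_card_lt`). At
this product vector the form is negative, a contradiction.

The existence of the solution says that the Segre cone of matrices of rank at most one, of dimension
`2n - 1`, meets a linear subspace of codimension at most `2n - 2` outside the vertex. The ideal of
the vertex has height at least `2n - 1` (`MvPolynomial.add_le_height_segrePrime`, by an explicit
chain of primes), so by Krull's height theorem it is not minimal over the linear equations. The
coordinate ring is a Jacobson ring, which gives a further maximal ideal containing the equations, and
the Nullstellensatz turns it into a nonzero matrix of rank one.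
-/

/-! ### Maximal ideals above few elements -/

/-- If a prime `m` has height larger than the number of elements of `s ⊆ m`, then by Krull's height
theorem `m` is not minimal over `s`. A smaller prime containing `s` is an intersection of maximal
ideals, one of which differs from `m`. -/
theorem exists_isMaximal_ne_of_card_lt_height {R : Type*} [CommRing R] [IsNoetherianRing R]
    [IsJacobsonRing R] (m : Ideal R) [m.IsPrime] (s : Finset R)
    (hs : (s : Set R) ⊆ m) (hcard : (s.card : ℕ∞) < m.height) :
    ∃ M : Ideal R, M.IsMaximal ∧ (s : Set R) ⊆ M ∧ M ≠ m := by
  by_contra! h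
  refine hcard.not_ge (Ideal.height_le_card_of_mem_minimalPrimes_span_finset (s := s)
    ⟨⟨inferInstance, Ideal.span_le.2 hs⟩, fun q ⟨hq, hsq⟩ _ => ?_⟩)
  rw [← IsJacobsonRing.out inferInstance hq.isRadical, Ideal.jacobson]
  refine le_sInf fun M ⟨hqM, hM⟩ => (h M hM ?_).ge
  exact (Ideal.span_le.1 hsq).trans hqM

/-! ### Linear sections of the Segre cone -/

namespace MvPolynomial

variable (n : ℕ) (K : Type*) [Field K]

/-- The homomorphism `z_ij ↦ x_i y_j`, where `x_i` is replaced by `0` for `i < a` and `y_j` for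
`j < b`. The variables `x` and `y` are indexed by the left and the right copy of `Fin n`. The case
`a = b = 0` is the Segre homomorphism. -/
noncomputable def truncatedSegre (a b : ℕ) :
    MvPolynomial (Fin n × Fin n) K →ₐ[K] MvPolynomial (Fin n ⊕ Fin n) K :=
  aeval fun p => (if a ≤ p.1 then X (Sum.inl p.1) else 0) *
    (if b ≤ p.2 then X (Sum.inr p.2) else 0)

/-- The coordinate ring of the cone of `n × n` matrices of rank at most one, realized as the
subalgebra of `K[x, y]` generated by the products `x_i y_j`. -/
noncomputable abbrev SegreRing : Subalgebra K (MvPolynomial (Fin n ⊕ Fin n) K) :=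
  (truncatedSegre n K 0 0).range

/-- The endomorphism of `K[x, y]` that sends `x_i` to `0` for `i < a` and `y_j` to `0` for `j < b`,
and fixes the other variables. -/
noncomputable def truncation (a b : ℕ) :
    MvPolynomial (Fin n ⊕ Fin n) K →ₐ[K] MvPolynomial (Fin n ⊕ Fin n) K :=
  aeval (Sum.elim (fun i => if a ≤ i.1 then X (Sum.inl i) else 0)
    (fun j => if b ≤ j.1 then X (Sum.inr j) else 0))

variable {n K}

theorem truncation_truncation {a b a' b' : ℕ} (ha : a ≤ a') (hb : b ≤ b')
    (p : MvPolynomial (Fin n ⊕ Fin n) K) :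
    truncation n K a' b' (truncation n K a b p) = truncation n K a' b' p := by
  rw [← AlgHom.comp_apply]
  congr 1
  ext1 (i | j)
  · simp only [truncation, AlgHom.comp_apply, aeval_X, Sum.elim_inl]
    split_ifs <;> first | omega | simp_all
  · simp only [truncation, AlgHom.comp_apply, aeval_X, Sum.elim_inr]
    split_ifs <;> first | omega | simp_all

theorem truncation_truncatedSegre (a b : ℕ) (p : MvPolynomial (Fin n × Fin n) K) :
    truncation n K a b (truncatedSegre n K 0 0 p) = truncatedSegre n K a b p := by
  rw [← AlgHom.comp_apply]
  congr 1
  ext1 p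
  simp [truncation, truncatedSegre]

variable (n K) in
/-- The prime of the Segre ring of the polynomials that vanish when `x_i = 0` for `i < a` and
`y_j = 0` for `j < b`. For `a = n` (or `b = n`) it is the ideal of the vertex of the cone. -/
noncomputable def segrePrime (a b : ℕ) : Ideal (SegreRing n K) :=
  RingHom.ker ((truncation n K a b).comp (SegreRing n K).val)

instance (a b : ℕ) : (segrePrime n K a b).IsPrime := RingHom.ker_isPrime _

theorem mem_segrePrime {a b : ℕ} {p : MvPolynomial (Fin n × Fin n) K} :
    (truncatedSegre n K 0 0).rangeRestrict p ∈ segrePrime n K a b ↔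
      truncatedSegre n K a b p = 0 := by
  rw [← truncation_truncatedSegre]; rfl

theorem segrePrime_mono {a b a' b' : ℕ} (ha : a ≤ a') (hb : b ≤ b') :
    segrePrime n K a b ≤ segrePrime n K a' b' := by
  intro p hp
  have hp : truncation n K a b p = 0 := hp
  change truncation n K a' b' p = 0
  rw [← truncation_truncation ha hb, hp, map_zero]

theorem segrePrime_lt_of_mem {a b a' b' : ℕ} (ha : a ≤ a') (hb : b ≤ b') (i j : Fin n)
    (hai : a ≤ i) (hbj : b ≤ j) (hij : i < a' ∨ j < b') :
    segrePrime n K a b < segrePrime n K a' b' := by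
  refine lt_of_le_not_ge (segrePrime_mono ha hb) fun h => ?_
  have h1 : (truncatedSegre n K 0 0).rangeRestrict (X (i, j)) ∈ segrePrime n K a' b' := by
    rw [mem_segrePrime]
    rcases hij with h | h <;> simp [truncatedSegre, Nat.not_le.2 h]
  have h2 := mem_segrePrime.1 (h h1)
  simp [truncatedSegre, hai, hbj, X_ne_zero] at h2

/-- The chain `(0, 0) < (0, 1) < ⋯ < (0, b) < (1, b) < ⋯ < (a, b)` of primes is strict: killing
`y_j` newly kills the generator `x_0 y_j`, and, as long as `b < n`, killing `x_i` newly kills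
`x_i y_b`. The case `a = n`, `b = n - 1` gives
height at least `2n - 1` at the vertex. -/
theorem add_le_height_segrePrime {a b : ℕ} (ha : a ≤ n) (hb : b + 1 ≤ n) :
    ((a + b : ℕ) : ℕ∞) ≤ (segrePrime n K a b).height := by
  induction a with
  | zero =>
    induction b with
    | zero => simp
    | succ b ih =>
      have hlt : segrePrime n K 0 b < segrePrime n K 0 (b + 1) :=
        segrePrime_lt_of_mem le_rfl (by omega) ⟨0, by omega⟩ ⟨b, by omega⟩ (by simp) (by simp)
          (by simp)
      have := Ideal.height_add_one_le_of_lt_of_isPrime hlt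
      refine le_trans ?_ this
      have := ih (by omega)
      push_cast at this ⊢
      rw [← add_assoc]
      gcongr
  | succ a ih =>
    have hlt : segrePrime n K a b < segrePrime n K (a + 1) b :=
      segrePrime_lt_of_mem (by omega) le_rfl ⟨a, by omega⟩ ⟨b, by omega⟩ (by simp) (by simp)
        (by simp)
    have := Ideal.height_add_one_le_of_lt_of_isPrime hlt
    refine le_trans ?_ this
    have := ih (by omega)
    push_cast at this ⊢
    rw [add_right_comm]
    gcongr

theorem exists_mul_eq_of_rank_le_one (c : Fin n × Fin n → K) (hc : c ≠ 0)
    (h : ∀ i j k l, c (i, j) * c (k, l) = c (i, l) * c (k, j)) :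
    ∃ x y : Fin n → K, x ≠ 0 ∧ y ≠ 0 ∧ ∀ i j, c (i, j) = x i * y j := by
  obtain ⟨⟨k, l⟩, hkl⟩ := Function.ne_iff.1 hc
  refine ⟨fun i => c (i, l), fun j => c (k, j) / c (k, l), fun h0 => hkl (congrFun h0 k),
    fun h0 => ?_, fun i j => ?_⟩
  · have := congrFun h0 l
    simp only [Pi.zero_apply] at this hkl
    rw [div_self hkl] at this
    exact one_ne_zero this
  · have := h i j k l
    simp only [Pi.zero_apply] at hkl
    field_simp
    exact this

/-- Over an algebraically closed field, fewer than `2n - 1` bilinear equations on `Kⁿ × Kⁿ` have a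
common zero with both components nonzero. The closed points of the Segre cone are the matrices of
rank at most one, and the equations cut out a closed set that is larger than the vertex. -/
theorem exists_common_zero_of_card_lt [IsAlgClosed K] {ι : Type*} (s : Finset ι)
    (hs : s.card + 1 < 2 * n) (L : ι → Fin n × Fin n → K) :
    ∃ x y : Fin n → K, x ≠ 0 ∧ y ≠ 0 ∧
      ∀ i ∈ s, ∑ p : Fin n × Fin n, L i p * (x p.1 * y p.2) = 0 := by
  classical
  set S := (truncatedSegre n K 0 0).rangeRestrict
  have hSs : Function.Surjective S := (truncatedSegre n K 0 0).rangeRestrict_surjective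
  have : Algebra.FiniteType K (SegreRing n K) := Algebra.FiniteType.of_surjective S hSs
  have : IsNoetherianRing (SegreRing n K) := Algebra.FiniteType.isNoetherianRing K _
  have : IsJacobsonRing (SegreRing n K) := isJacobsonRing_of_finiteType (A := K)
  let ℓ : ι → MvPolynomial (Fin n × Fin n) K := fun i => ∑ p, C (L i p) * X p
  have hX (p : Fin n × Fin n) : S (X p) ∈ segrePrime n K n (n - 1) := by
    rw [mem_segrePrime]
    simp [truncatedSegre, Nat.not_le.2 p.1.2]
  obtain ⟨M, hM, hsM, hne⟩ := exists_isMaximal_ne_of_card_lt_height (segrePrime n K n (n - 1))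
    (s.image (S ∘ ℓ)) (by
      intro r hr
      obtain ⟨i, -, rfl⟩ := by simpa using hr
      simp only [ℓ, map_sum, map_mul]
      exact sum_mem fun p _ => Ideal.mul_mem_left _ _ (hX p)) (by
      refine lt_of_lt_of_le ?_ (add_le_height_segrePrime le_rfl (by omega))
      have := Finset.card_image_le (s := s) (f := S ∘ ℓ)
      exact_mod_cast (by omega))
  have : (M.comap S).IsMaximal := Ideal.comap_isMaximal_of_surjective S hSs
  obtain ⟨c, hc⟩ := eq_vanishingIdeal_singleton_of_isMaximal K this
  have hmem (p : MvPolynomial (Fin n × Fin n) K) : S p ∈ M ↔ eval c p = 0 := by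
    rw [← Ideal.mem_comap, hc]; simp [aeval_eq_eval]
  -- At the origin, evaluation agrees with the homomorphism whose kernel is the vertex ideal.
  have hc0 : c ≠ 0 := by
    rintro rfl
    refine hne (hM.eq_of_le (Ideal.IsPrime.ne_top inferInstance) fun r hr => ?_)
    obtain ⟨p, rfl⟩ := hSs r
    rw [hmem] at hr
    rw [mem_segrePrime]
    have : truncatedSegre n K n (n - 1) =
        (Algebra.ofId K _).comp (aeval (0 : Fin n × Fin n → K)) := by
      ext1 p
      simp [truncatedSegre, Nat.not_le.2 p.1.2]
    rw [this, AlgHom.comp_apply, aeval_eq_eval]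
    exact (congrArg (Algebra.ofId K _) hr).trans (map_zero _)
  obtain ⟨x, y, hx, hy, hxy⟩ := exists_mul_eq_of_rank_le_one c hc0 fun i j k l => by
    have h : S (X (i, j) * X (k, l) - X (i, l) * X (k, j)) ∈ M := by
      convert M.zero_mem
      refine Subtype.ext ?_
      change truncatedSegre n K 0 0 _ = 0
      simp only [truncatedSegre, map_sub, map_mul, aeval_X, Nat.zero_le, if_true]
      ring
    rw [hmem] at h
    simpa [sub_eq_zero] using h
  refine ⟨x, y, hx, hy, fun i hi => ?_⟩
  have h : S (ℓ i) ∈ M := hsM (by simpa using ⟨i, hi, rfl⟩)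
  rw [hmem] at h
  simpa [ℓ, hxy] using h

end MvPolynomial

/-! ### Descartes' rule for real-rooted polynomials -/

namespace Polynomial

theorem coeff_comp_neg_X {R : Type*} [CommRing R] (p : R[X]) (k : ℕ) :
    (p.comp (-X)).coeff k = (-1) ^ k * p.coeff k := by
  rw [mul_comm, ← comp_C_mul_X_coeff]
  simp

/-- Two consecutive nonzero terms whose degrees differ by `d` contribute at most `d` sign variations
to `P(x)` and `P(-x)` together: if `d = 1`, exactly one of the two polynomials has a variation
there, and if `d ≥ 2` the bound is trivial. -/
theorem signVariations_add_signVariations_comp_neg_X_le {P : ℝ[X]} (hP : P ≠ 0) :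
    P.signVariations + (P.comp (-X)).signVariations + P.natTrailingDegree ≤ P.natDegree := by
  induction h : P.support.card using Nat.strong_induction_on generalizing P with
  | _ m ih =>
  have hne (Q : ℝ[X]) (h : Q ≠ 0) : Q.comp (-X) ≠ 0 :=
    comp_neg_X_eq_zero_iff.not.2 h
  have hdeg (Q : ℝ[X]) : (Q.comp (-X)).natDegree = Q.natDegree := by simp [natDegree_comp]
  have hlc (Q : ℝ[X]) : (Q.comp (-X)).leadingCoeff = (-1) ^ Q.natDegree * Q.leadingCoeff := by
    rw [leadingCoeff, hdeg, coeff_comp_neg_X, leadingCoeff]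
  have herase : (P.comp (-X)).eraseLead = P.eraseLead.comp (-X) := by
    ext k
    simp only [eraseLead_coeff, hdeg, coeff_comp_neg_X]
    split_ifs <;> simp
  rw [signVariations_eq_eraseLead_add_ite hP, signVariations_eq_eraseLead_add_ite (hne P hP),
    herase, hlc, hlc]
  by_cases h0 : P.eraseLead = 0
  · simp [h0, hP, natTrailingDegree_le_natDegree]
  have hlt : P.eraseLead.natDegree < P.natDegree :=
    natDegree_lt_natDegree h0 (degree_eraseLead_lt hP)
  have ih := ih _ (h ▸ eraseLead_support_card_lt hP) h0 rfl
  have htr : P.natTrailingDegree ≤ P.eraseLead.natTrailingDegree := by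
    refine natTrailingDegree_le_of_mem_supp _ ?_
    have := natTrailingDegree_mem_support_of_nonzero h0
    rw [eraseLead_support] at this
    exact Finset.mem_of_mem_erase this
  set d := P.natDegree
  set e := P.eraseLead.natDegree
  rcases Nat.lt_or_ge (e + 1) d with hde | hde
  · split_ifs <;> omega
  have hd : d = e + 1 := by omega
  have hl0 : P.eraseLead.leadingCoeff ≠ 0 := leadingCoeff_ne_zero.2 h0
  -- For consecutive degrees the two sign changes exclude each other.
  have : ¬ (SignType.sign P.leadingCoeff = -SignType.sign P.eraseLead.leadingCoeff ∧
      SignType.sign ((-1) ^ d * P.leadingCoeff) =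
        -SignType.sign ((-1) ^ e * P.eraseLead.leadingCoeff)) := by
    rintro ⟨h1, h2⟩
    rw [hd, pow_succ, sign_mul, sign_mul, sign_mul, h1] at h2
    have h3 : SignType.sign ((-1 : ℝ) ^ e) ≠ 0 := by simp
    have h4 : SignType.sign P.eraseLead.leadingCoeff ≠ 0 := by simpa using hl0
    have h5 : SignType.sign (-1 : ℝ) = -1 := by simp
    rw [h5] at h2
    have key : ∀ u v : SignType, u ≠ 0 → v ≠ 0 → u * -1 * -v ≠ -(u * v) := by decide
    exact key _ _ h3 h4 h2
  split_ifs <;> first | omega | (exfalso; tauto)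

/-- A real-rooted polynomial has no more sign variations than positive roots: the roots `-l i` of
the product with `0 < l i` are at most the sign variations of `P(-x)`, by Descartes' rule, and those
with `l i = 0` are counted by the trailing degree. -/
theorem signVariations_prod_add_card_le {ι : Type*} (s : Finset ι) (l : ι → ℝ) :
    (∏ i ∈ s, (X + C (l i))).signVariations + (s.filter fun i => 0 ≤ l i).card ≤ s.card := by
  classical
  set P := ∏ i ∈ s, (X + C (l i)) with hPdef
  have hP : P.Monic := monic_prod_of_monic _ _ fun i _ => monic_X_add_C _
  have hdeg : P.natDegree = s.card := by
    rw [hPdef, natDegree_prod_of_monic _ _ fun i _ => monic_X_add_C _]; simp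
  have h1 := signVariations_add_signVariations_comp_neg_X_le hP.ne_zero
  have hroots : P.roots = s.val.map fun i => -l i := by
    have := roots_multiset_prod_X_sub_C (s.val.map fun i => -l i)
    simpa [Multiset.map_map, Function.comp_def] using this
  have hpos : (s.filter fun i => 0 < l i).card ≤ (P.comp (-X)).signVariations := by
    refine le_trans (le_of_eq ?_) (roots_countP_pos_le_signVariations _)
    rw [roots_comp_neg_X, hroots, Multiset.map_map, Multiset.countP_map]
    simp [Finset.card_def]
  have hzero : (s.filter fun i => l i = 0).card = P.natTrailingDegree := by
    rw [← rootMultiplicity_eq_natTrailingDegree', ← count_roots, hroots, Multiset.count_map]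
    simp [Finset.card_def, eq_comm]
  have hsplit : (s.filter fun i => 0 ≤ l i).card =
      (s.filter fun i => 0 < l i).card + (s.filter fun i => l i = 0).card := by
    rw [← Finset.card_union_of_disjoint]
    · congr 1; ext i; simp [le_iff_lt_or_eq]; grind
    · rw [Finset.disjoint_filter]; grind
  omega

end Polynomial

/-! ### Sign variation formulas -/

namespace Superop

theorem SignVariationFormula.Holds.forall₂ {φ : SignVariationFormula} {t : ℝ} (h : φ.Holds t) :
    List.Forall₂ (fun a s => componentHolds a t s) φ.domain φ.type := by
  induction φ with
  | atom s a => exact .cons h .nil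
  | conj φ s a ih => exact List.rel_append (ih h.1) (.cons h.2 .nil)

theorem coeffSeq_eq_cons {f : ℝ[X][X]} (hf : f ≠ 0) :
    coeffSeq f = f.leadingCoeff :: coeffSeq f.eraseLead := by
  have hs : f.support =
      Finset.cons f.natDegree f.eraseLead.support (by simp [eraseLead_coeff]) := by
    rw [Finset.cons_eq_insert, eraseLead_support, Finset.insert_erase]
    simpa using hf
  unfold coeffSeq
  rw [hs, Finset.sort_cons, List.map_cons]
  · congr 1
    refine List.map_congr_left fun k hk => ?_
    have : k ∈ f.eraseLead.support := (Finset.mem_sort _).1 hk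
    rw [eraseLead_support] at this
    rw [eraseLead_coeff_of_ne _ (Finset.ne_of_mem_erase this)]
  · intro k hk
    exact (le_natDegree_of_mem_supp k hk).trans (eraseLead_natDegree_le_aux)

theorem componentHolds.sign_eq_neg_iff {a b : ℝ[X]} {t : ℝ} {r s : Sgn}
    (ha : componentHolds a t r) (hb : componentHolds b t s) :
    SignType.sign (a.eval t) = -SignType.sign (b.eval t) ↔ r ≠ s := by
  cases r <;> cases s <;> simp only [componentHolds] at ha hb <;> simp [ha, hb]

theorem componentHolds.eval_ne_zero {a : ℝ[X]} {t : ℝ} {s : Sgn}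
    (ha : componentHolds a t s) : a.eval t ≠ 0 := by
  cases s
  exacts [ne_of_gt ha, ne_of_lt ha]

/-- Where a sign variation formula holds, no coefficient vanishes, so that specialization commutes
with erasing the leading term and the word records all sign variations of `f(t, ·)`. -/
theorem signVariations_specialize {σ : List Sgn} {f : ℝ[X][X]} {t : ℝ}
    (h : List.Forall₂ (fun a s => componentHolds a t s) (coeffSeq f) σ) :
    (specialize f t).signVariations = signVariations σ := by
  induction σ generalizing f with
  | nil =>
    by_cases hf : f = 0
    · simp [hf, specialize, signVariations]
    · simp [coeffSeq_eq_cons hf] at h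
  | cons s w ih =>
    have hf : f ≠ 0 := by rintro rfl; simp [coeffSeq] at h
    rw [coeffSeq_eq_cons hf, List.forall₂_cons] at h
    obtain ⟨hs, hw⟩ := h
    have hlc : evalRingHom t f.leadingCoeff ≠ 0 := hs.eval_ne_zero
    have hne : specialize f t ≠ 0 := by
      intro h0
      have := congrArg (coeff · f.natDegree) h0
      simp only [specialize, coeff_map, coeff_zero] at this
      exact hlc this
    have herase : (specialize f t).eraseLead = specialize f.eraseLead t := by
      ext k
      simp only [specialize, eraseLead_coeff, coeff_map,
        natDegree_map_of_leadingCoeff_ne_zero _ hlc]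
      split_ifs <;> simp
    have hl : (specialize f t).leadingCoeff = f.leadingCoeff.eval t :=
      leadingCoeff_map_of_leadingCoeff_ne_zero _ hlc
    rw [signVariations_eq_eraseLead_add_ite hne, herase, ih hw, hl]
    cases w with
    | nil =>
      have h0 : f.eraseLead = 0 := by
        by_contra h0
        simp [coeffSeq_eq_cons h0] at hw
      have := hs.eval_ne_zero
      simp [h0, specialize, signVariations, this]
    | cons b w =>
      have h0 : f.eraseLead ≠ 0 := by intro h0; simp [h0, coeffSeq] at hw
      rw [coeffSeq_eq_cons h0, List.forall₂_cons] at hw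
      have hlc' : evalRingHom t f.eraseLead.leadingCoeff ≠ 0 := hw.1.eval_ne_zero
      have hl' : (specialize f.eraseLead t).leadingCoeff = f.eraseLead.leadingCoeff.eval t :=
        leadingCoeff_map_of_leadingCoeff_ne_zero _ hlc'
      rw [hl', signVariations, add_comm]
      congr 1
      simp only [hs.sign_eq_neg_iff hw.1, ne_eq, ite_not]

end Superop

open scoped Matrix

/-! ### The Choi–Jamiołkowski matrix of a family -/

namespace Superop

theorem detSub_eq_charpoly {R ι : Type*} [CommRing R] [Fintype ι] [DecidableEq ι]
    (M : Matrix ι ι R) : detSub M = (-1) ^ Fintype.card ι * M.charpoly := by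
  rw [detSub, Matrix.charpoly, ← Matrix.det_neg, Matrix.charmatrix, neg_sub]
  congr 2
  rw [Matrix.smul_one_eq_diagonal]
  rfl

variable {n : ℕ}

theorem IsOneParameterFamily.isHermitian_cjMatrix {Φ : ℝ → Superoperator n}
    (hΦ : IsOneParameterFamily Φ) (t : ℝ) : (cjMatrix (Φ t)).IsHermitian := by
  obtain ⟨s, -, α, A, -, hA⟩ := hΦ
  ext ⟨i, j⟩ ⟨k, l⟩
  rw [Matrix.conjTranspose_apply, cjMatrix_apply, cjMatrix_apply, ← Matrix.conjTranspose_apply]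
  suffices h : (Φ t (Matrix.single k i 1))ᴴ = Φ t (Matrix.single i k 1) by rw [h]
  simp only [hA, Matrix.conjTranspose_sum, Matrix.conjTranspose_smul, Matrix.conjTranspose_mul,
    Matrix.conjTranspose_conjTranspose, Matrix.conjTranspose_single, Matrix.mul_assoc, star_one,
    Complex.star_def, Complex.conj_ofReal]

/-- The real polynomial `χ⁻(t, ·)` splits, and its roots are the negatives of the eigenvalues of the
Choi–Jamiołkowski matrix. -/
theorem specialize_negVar_familyCharPoly {Φ : ℝ → Superoperator n}
    (hΦ : IsOneParameterFamily Φ) (t : ℝ) :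
    specialize (negVar (familyCharPoly Φ hΦ)) t =
      ∏ p, (X + C ((hΦ.isHermitian_cjMatrix t).eigenvalues p)) := by
  have h : specialize (familyCharPoly Φ hΦ) t =
      ∏ p, (C ((hΦ.isHermitian_cjMatrix t).eigenvalues p) - X) := by
    refine map_injective _ Complex.ofRealHom.injective ?_
    rw [familyCharPoly_spec, charPoly, detSub_eq_charpoly,
      (hΦ.isHermitian_cjMatrix t).charpoly_eq, Polynomial.map_prod, ← Finset.card_univ,
      ← Finset.prod_const, ← Finset.prod_mul_distrib]
    refine Finset.prod_congr rfl fun p _ => ?_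
    simp
  have h2 : specialize (negVar (familyCharPoly Φ hΦ)) t =
      (specialize (familyCharPoly Φ hΦ) t).comp (-X) := by
    simp [specialize, negVar, Polynomial.map_comp]
  rw [h2, h, prod_comp]
  refine Finset.prod_congr rfl fun p _ => ?_
  simp [add_comm]

/-- The hermitian form of the Choi–Jamiołkowski matrix at a product vector `x ⊗ y` is a value of the
hermitian form of the image of a matrix of rank one. -/
theorem star_dotProduct_cjMatrix_mulVec (Φ : Superoperator n) (x y : Fin n → ℂ) :
    star (fun p : Fin n × Fin n => x p.1 * y p.2) ⬝ᵥ
      cjMatrix Φ *ᵥ (fun p : Fin n × Fin n => x p.1 * y p.2) =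
    star y ⬝ᵥ Φ (Matrix.vecMulVec (star x) x) *ᵥ y := by
  have h : Matrix.vecMulVec (star x) x =
      ∑ i, ∑ k, (star (x i) * x k) • Matrix.single i k (1 : ℂ) := by
    rw [Matrix.matrix_eq_sum_single (Matrix.vecMulVec (star x) x)]
    simp [Matrix.vecMulVec_apply, Matrix.smul_single]
  simp only [h, map_sum, map_smul, Matrix.sum_mulVec, Matrix.smul_mulVec, dotProduct_sum,
    dotProduct_smul]
  simp only [dotProduct, Matrix.mulVec, Fintype.sum_prod_type, cjMatrix_apply, Finset.mul_sum,
    Pi.star_apply, star_mul', smul_eq_mul]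
  refine Finset.sum_congr rfl fun i _ => ?_
  rw [Finset.sum_comm]
  refine Finset.sum_congr rfl fun k _ => ?_
  refine Finset.sum_congr rfl fun j _ => ?_
  refine Finset.sum_congr rfl fun l _ => ?_
  ring

theorem IsPositive.cjMatrix_product_nonneg {Φ : Superoperator n} (hΦ : IsPositive Φ)
    (x y : Fin n → ℂ) :
    0 ≤ star (fun p : Fin n × Fin n => x p.1 * y p.2) ⬝ᵥ
      cjMatrix Φ *ᵥ (fun p : Fin n × Fin n => x p.1 * y p.2) := by
  rw [star_dotProduct_cjMatrix_mulVec]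
  refine (hΦ _ ?_).dotProduct_mulVec_nonneg y
  simpa using Matrix.posSemidef_vecMulVec_self_star (star x)

end Superop

/-! ### Negative eigenvalues and positivity -/

open Matrix in
/-- The hermitian form of `A` is negative on the span of the eigenvectors with negative eigenvalues,
given here as the orthogonal complement of the other eigenvectors. -/
theorem Matrix.IsHermitian.re_dotProduct_mulVec_neg {ι : Type*} [Fintype ι] [DecidableEq ι]
    {A : Matrix ι ι ℂ} (hA : A.IsHermitian) {v : ι → ℂ} (hv : v ≠ 0)
    (h : ∀ i, 0 ≤ hA.eigenvalues i → star (hA.eigenvectorBasis i : ι → ℂ) ⬝ᵥ v = 0) :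
    (star v ⬝ᵥ A *ᵥ v).re < 0 := by
  set U : Matrix ι ι ℂ  := (hA.eigenvectorUnitary : Matrix ι ι ℂ) with hU
  have hUU : U * star U = 1 := Unitary.coe_mul_star_self hA.eigenvectorUnitary
  set c := star U *ᵥ v with hcdef
  have hvc : v = U *ᵥ c := by rw [hcdef, mulVec_mulVec, hUU, one_mulVec]
  have hc (i : ι) : c i = star (hA.eigenvectorBasis i : ι → ℂ) ⬝ᵥ v := by
    simp [hcdef, hU, mulVec, dotProduct, star_apply, eigenvectorUnitary_apply]
  have hform : star v ⬝ᵥ A *ᵥ v = ∑ i, ((hA.eigenvalues i * Complex.normSq (c i) : ℝ) : ℂ) := by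
    have hspec : A = U * diagonal (fun i => (hA.eigenvalues i : ℂ)) * star U := by
      conv_lhs => rw [hA.spectral_theorem, Unitary.conjStarAlgAut_apply]
      rfl
    have : star v ⬝ᵥ A *ᵥ v =
        star c ⬝ᵥ diagonal (fun i => (hA.eigenvalues i : ℂ)) *ᵥ c := by
      conv_lhs => rw [hspec, ← mulVec_mulVec, ← mulVec_mulVec, dotProduct_mulVec]
      rw [hcdef, star_mulVec, star_eq_conjTranspose, conjTranspose_conjTranspose]
    rw [this]
    refine Finset.sum_congr rfl fun i _ => ?_
    rw [mulVec_diagonal, Complex.ofReal_mul, Complex.normSq_eq_conj_mul_self, Pi.star_apply,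
      Complex.star_def]
    ring
  rw [hform, ← Complex.ofReal_sum, Complex.ofReal_re]
  have hc0 : c ≠ 0 := fun h0 => hv (by rw [hvc, h0, mulVec_zero])
  obtain ⟨i, hi⟩ := Function.ne_iff.1 hc0
  refine Finset.sum_neg' (fun j _ => ?_) ⟨i, Finset.mem_univ i, ?_⟩
  · rcases le_or_gt 0 (hA.eigenvalues j) with hj | hj
    · simp [hc, h j hj]
    · exact mul_nonpos_of_nonpos_of_nonneg hj.le (Complex.normSq_nonneg _)
  · refine mul_neg_of_neg_of_pos (not_le.1 fun hj => hi ?_) (Complex.normSq_pos.2 hi)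
    rw [hc, h i hj, Pi.zero_apply]

namespace Superop
variable {n : ℕ}

/-- For a positive `Φ`, at least `2n - 1` eigenvalues of the Choi–Jamiołkowski matrix are
nonnegative. Otherwise some nonzero product vector is orthogonal to all the corresponding
eigenvectors, and the hermitian form is negative there. -/
theorem IsPositive.two_mul_le_card_nonneg_eigenvalues_add_one {Φ : Superoperator n}
    (hΦ : IsPositive Φ) (hM : (cjMatrix Φ).IsHermitian) :
    2 * n ≤ (Finset.univ.filter fun p => 0 ≤ hM.eigenvalues p).card + 1 := by
  by_contra! hlt
  obtain ⟨x, y, hx, hy, h⟩ := MvPolynomial.exists_common_zero_of_card_lt (K := ℂ) _ hlt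
    (fun p => star (hM.eigenvectorBasis p : Fin n × Fin n → ℂ))
  obtain ⟨i, hi⟩ := Function.ne_iff.1 hx
  obtain ⟨j, hj⟩ := Function.ne_iff.1 hy
  have hneg := hM.re_dotProduct_mulVec_neg (v := fun p => x p.1 * y p.2)
    (Function.ne_iff.2 ⟨(i, j), mul_ne_zero hi hj⟩) fun p hp => h p (by simpa using hp)
  exact hneg.not_ge (Complex.le_def.1 (hΦ.cjMatrix_product_nonneg x y)).1

theorem not_isPositive_of_holds {Φ : ℝ → Superoperator n}
    (hΦ : IsOneParameterFamily Φ) {σ : List Sgn} {φ : SignVariationFormula}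
    (hφ : φ.IsOfTypeFor σ (negVar (familyCharPoly Φ hΦ)))
    (hσ : (n : ℤ) ^ 2 - 2 * (n : ℤ) + 2 ≤ (signVariations σ : ℤ)) {t : ℝ} (ht : φ.Holds t) :
    ¬ IsPositive (Φ t) := by
  intro hpos
  have h1 := ht.forall₂
  rw [hφ.1, hφ.2] at h1
  have h2 := signVariations_specialize h1
  have h3 := Polynomial.signVariations_prod_add_card_le Finset.univ
    (hΦ.isHermitian_cjMatrix t).eigenvalues
  rw [← specialize_negVar_familyCharPoly hΦ, h2] at h3
  have h4 := hpos.two_mul_le_card_nonneg_eigenvalues_add_one (hΦ.isHermitian_cjMatrix t)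
  simp only [Finset.card_univ, Fintype.card_prod, Fintype.card_fin] at h3
  zify at h3 h4
  -- `λ(σ) ≤ n² - (2n - 1)` contradicts the assumption on `σ`.
  nlinarith

end Superop

theorem theorem5p5 (n : ℕ) (Φ : ℝ → Superop.Superoperator n)
    (hΦ : Superop.IsOneParameterFamily Φ)
    (σ : List Superop.Sgn) (φ : Superop.SignVariationFormula)
    (hφ : φ.IsOfTypeFor σ (Superop.negVar (Superop.familyCharPoly Φ hΦ)))
    (hσ : (n : ℤ) ^ 2 - 2 * (n : ℤ) + 2 ≤ (Superop.signVariations σ : ℤ)) :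
    ((∀ t : ℝ, φ.Holds t) → Superop.GloballyNonpositive Φ) ∧
    ((∃ u v : ℝ, u < v ∧ ∀ t ∈ Set.Ioo u v, φ.Holds t) → Superop.LocallyNonpositive Φ) ∧
    ((∃ t : ℝ, φ.Holds t) → Superop.PointwiseNonpositive Φ) := by
  have key {t : ℝ} (ht : φ.Holds t) := Superop.not_isPositive_of_holds hΦ hφ hσ ht
  exact ⟨fun h t => key (h t), fun ⟨u, v, huv, h⟩ => ⟨u, v, huv, fun t ht => key (h t ht)⟩,
    fun ⟨t, h⟩ => ⟨t, key h⟩⟩
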